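/- For $n\ge 1$ let $\mathbb{C}P^n$ be complex projective space with the Fubini–Study metric, whose fundamental form is $$\omega_{FS}=\frac{\sqrt{-1}}{2\pi}\,\partial\bar\partial\log\Bigl(1+\sum_{i=1}^n|z_i|^2\Bigr)$$ in affine coordinates. For a holomorphic map $f:\mathbb{C}\to\mathbb{C}P^n$ let $|df|(z)\ge 0$ be defined by $f^*\omega_{FS}=|df|^2\,dx\wedge dy$ (equivalently $|df|(z)=\sqrt2\,|df(\partial/\partial z)|$). Let $\mathcal{M}(\mathbb{C}P^n)$ be the set of holomorphic maps $f:\mathbb{C}\to\mathbb{C}P^n$ with $|df|(z)\le 1$ for all $z\in\mathbb{C}$, let $$\rho(f)=\limsup_{R\to\infty}\frac1{\pi R^2}\int_{|z|\le R}|df|^2\,dx\,dy$$ be the packing density of $f\in\mathcal{M}(\mathbb{C}P^n)$, and let $$\rho(\mathbb{C}P^n)=\sup_{f\in\mathcal{M}(\mathbb{C}P^n)}\rho(f)$$ be the holomorphic capacity of $\mathbb{C}P^n$. **Theorem.** The capacities are non-decreasing in $n$, that is, $\rho(\mathbb{C}P^n)\le\rho(\mathbb{C}P^{n+1})$ for all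 $n\ge 1$, and $$\lim_{n\to\infty}\rho(\mathbb{C}P^n)=1 .$$ -/

import Mathlib

open scoped LinearAlgebra.Projectivization Manifold ContDiff ENNReal Topology
open MeasureTheory Filter

noncomputable section

/-- The complex projective space `ℂPⁿ` of lines in `ℂⁿ⁺¹`. -/
abbrev CP (n : ℕ) : Type := ℙ ℂ (Fin (n + 1) → ℂ)

namespace CP

variable {n : ℕ}

/-- The space of nonzero vectors, i.e. of homogeneous coordinates. -/
abbrev Homog (n : ℕ) : Type := {v : Fin (n + 1) → ℂ // v ≠ 0}

theorem continuous_homog (i : Fin (n + 1)) : Continuous fun v : Homog n => v.1 i :=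
  (continuous_apply i).comp continuous_subtype_val

/-- The projection `(z₀, …, zₙ) ↦ [z₀ : ⋯ : zₙ]`. -/
def proj (v : Homog n) : CP n := Projectivization.mk' ℂ v

/-- `ℂPⁿ` carries the quotient topology. -/
instance : TopologicalSpace (CP n) := TopologicalSpace.coinduced proj inferInstance

theorem proj_surjective : Function.Surjective (proj (n := n)) := Quotient.mk''_surjective

theorem isQuotientMap_proj : Topology.IsQuotientMap (proj (n := n)) := ⟨⟨rfl⟩, proj_surjective⟩

theorem proj_eq_iff (v w : Homog n) :
    proj v = proj w ↔ ∃ a : ℂˣ, a • (w : Fin (n + 1) → ℂ) = v :=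
  Projectivization.mk_eq_mk_iff ℂ v.1 w.1 v.2 w.2

/-- The affine coordinates `(z_k / z_i)_{k ≠ i}` on `U_i = {z_i ≠ 0}`. -/
def affineCoord (i : Fin (n + 1)) : CP n → (Fin n → ℂ) :=
  Projectivization.lift (fun v k => v.1 (i.succAbove k) / v.1 i) (by
    rintro ⟨a, ha⟩ ⟨b, hb⟩ t (h : a = t • b)
    have ht : t ≠ 0 := by rintro rfl; exact ha (by simp [h])
    funext k
    simp only [h, Pi.smul_apply, smul_eq_mul]
    exact mul_div_mul_left _ _ ht)

theorem affineCoord_proj (i : Fin (n + 1)) (v : Homog n) :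
    affineCoord i (proj v) = fun k => v.1 (i.succAbove k) / v.1 i := rfl

theorem insertNth_one_ne_zero (i : Fin (n + 1)) (w : Fin n → ℂ) :
    (i.insertNth (1 : ℂ) w : Fin (n + 1) → ℂ) ≠ 0 := by
  intro h
  simpa using congrFun h i

/-- The inverse of the affine coordinates, which inserts the coordinate `1` in position `i`. -/
def affineInv (i : Fin (n + 1)) (w : Fin n → ℂ) : CP n :=
  proj ⟨i.insertNth (1 : ℂ) w, insertNth_one_ne_zero i w⟩

/-- The open set `U_i = {z_i ≠ 0}`. -/
def affineOpen (i : Fin (n + 1)) : Set (CP n) := {x | x.rep i ≠ 0}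

theorem proj_mem_affineOpen (i : Fin (n + 1)) (v : Homog n) :
    proj v ∈ affineOpen i ↔ v.1 i ≠ 0 := by
  have h : proj ⟨(proj v).rep, (proj v).rep_nonzero⟩ = proj v := Projectivization.mk_rep _
  obtain ⟨a, ha⟩ := (proj_eq_iff _ _).1 h
  have hi : (proj v).rep i = (a : ℂ) * v.1 i := by
    have := congrFun ha i
    simpa [Units.smul_def] using this.symm
  simp [affineOpen, hi]

theorem isOpen_affineOpen (i : Fin (n + 1)) : IsOpen (affineOpen (n := n) i) := by
  rw [← isQuotientMap_proj.isOpen_preimage]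
  have : proj ⁻¹' affineOpen (n := n) i = {v : Homog n | v.1 i ≠ 0} := by
    ext v; exact proj_mem_affineOpen i v
  rw [this]
  exact isOpen_ne_fun (continuous_homog i) continuous_const

theorem affineCoord_affineInv (i : Fin (n + 1)) (w : Fin n → ℂ) :
    affineCoord i (affineInv i w) = w := by
  funext k
  simp [affineInv, affineCoord_proj]

theorem affineInv_affineCoord (i : Fin (n + 1)) (x : CP n) (hx : x ∈ affineOpen i) :
    affineInv i (affineCoord i x) = x := by
  obtain ⟨v, rfl⟩ := proj_surjective x
  rw [proj_mem_affineOpen] at hx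
  refine (proj_eq_iff _ _).2 ⟨(Units.mk0 (v.1 i) hx)⁻¹, ?_⟩
  funext k
  refine Fin.succAboveCases i ?_ (fun k => ?_) k
  · simp [Units.smul_def, hx]
  · simp [Units.smul_def, affineCoord_proj, div_eq_inv_mul]

/-- The standard affine chart `U_i → ℂⁿ` of `ℂPⁿ`. -/
def affineChart (i : Fin (n + 1)) : OpenPartialHomeomorph (CP n) (Fin n → ℂ) where
  toFun := affineCoord i
  invFun := affineInv i
  source := affineOpen i
  target := Set.univ
  map_source' _ _ := Set.mem_univ _
  map_target' w _ := by
    refine (proj_mem_affineOpen i _).2 ?_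
    simp
  left_inv' x hx := affineInv_affineCoord i x hx
  right_inv' w _ := affineCoord_affineInv i w
  open_source := isOpen_affineOpen i
  open_target := isOpen_univ
  continuousOn_toFun := by
    rw [isQuotientMap_proj.continuousOn_isOpen_iff (isOpen_affineOpen i)]
    refine continuousOn_pi.2 fun k => ?_
    refine ContinuousOn.div (continuous_homog _).continuousOn (continuous_homog i).continuousOn fun v hv => ?_
    exact (proj_mem_affineOpen i v).1 hv
  continuousOn_invFun := by
    refine (isQuotientMap_proj.continuous.comp ?_).continuousOn
    refine Continuous.subtype_mk (continuous_pi fun k => ?_) _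
    refine Fin.succAboveCases i ?_ (fun k => ?_) k
    · simpa using continuous_const
    · simpa using continuous_apply k

theorem exists_mem_affineOpen (x : CP n) : ∃ i, x ∈ affineOpen i :=
  Function.ne_iff.1 x.rep_nonzero

instance : ChartedSpace (Fin n → ℂ) (CP n) where
  atlas := Set.range affineChart
  chartAt x := affineChart (exists_mem_affineOpen x).choose
  mem_chart_source x := (exists_mem_affineOpen x).choose_spec
  chart_mem_atlas _ := Set.mem_range_self _

/-- `ℂPⁿ` is a complex manifold: the transition maps of the affine charts are holomorphic. -/
instance : IsManifold 𝓘(ℂ, Fin n → ℂ) ω (CP n) := by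
  refine isManifold_of_contDiffOn _ _ _ ?_
  rintro _ _ ⟨i, rfl⟩ ⟨j, rfl⟩
  have hc : ∀ k : Fin (n + 1),
      ContDiff ℂ ω fun w : Fin n → ℂ => (i.insertNth (1 : ℂ) w : Fin (n + 1) → ℂ) k := by
    intro k
    refine Fin.succAboveCases i ?_ (fun k => ?_) k
    · simpa using contDiff_const
    · simpa using contDiff_apply ℂ ℂ k
  refine contDiffOn_pi.2 fun k => ?_
  refine ContDiffOn.div (hc _).contDiffOn (hc _).contDiffOn fun w hw => ?_
  simp only [modelWithCornersSelf_coe_symm, modelWithCornersSelf_coe, Set.preimage_id_eq, id_eq,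
    Set.range_id, Set.inter_univ, OpenPartialHomeomorph.trans_source,
    OpenPartialHomeomorph.symm_source] at hw
  exact (proj_mem_affineOpen j _).1 hw.2

/-- The Wirtinger derivative `∂u/∂z_i = (∂u/∂x_i - √-1 ∂u/∂y_i) / 2`. -/
def wirtinger (i : Fin n) (u : (Fin n → ℂ) → ℂ) (w : Fin n → ℂ) : ℂ :=
  (fderiv ℝ u w (Pi.single i 1) - Complex.I * fderiv ℝ u w (Pi.single i Complex.I)) / 2

/-- The Wirtinger derivative `∂u/∂z̄_i = (∂u/∂x_i + √-1 ∂u/∂y_i) / 2`. -/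
def wirtingerBar (i : Fin n) (u : (Fin n → ℂ) → ℂ) (w : Fin n → ℂ) : ℂ :=
  (fderiv ℝ u w (Pi.single i 1) + Complex.I * fderiv ℝ u w (Pi.single i Complex.I)) / 2

/-- The Kähler potential `log (1 + ∑ |z_k|²)` in affine coordinates. -/
def potential (w : Fin n → ℂ) : ℂ := (Real.log (1 + ∑ k, ‖w k‖ ^ 2) : ℝ)

/-- The coefficients `g_{ij̄} = (1 / 2π) ∂² log (1 + ∑ |z_k|²) / ∂z_i ∂z̄_j` of the
Fubini–Study metric in affine coordinates, so that
`ω_FS = √-1 ∑ g_{ij̄} dz_i ∧ dz̄_j = (√-1 / 2π) ∂∂̄ log (1 + ∑ |z_k|²)`. -/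
def fubiniStudyCoeff (i j : Fin n) (w : Fin n → ℂ) : ℂ :=
  1 / (2 * (Real.pi : ℂ)) * wirtinger i (wirtingerBar j potential) w

/-- The Hermitian inner product `⟨u, v⟩ = ∑ g_{ij̄} u_i v̄_j` of the Fubini–Study metric on
the holomorphic tangent space at `x`, with `⟨∂/∂z_i, ∂/∂z_j⟩ = g_{ij̄}`. The tangent space at `x`
is `ℂⁿ` through the affine chart `chartAt (Fin n → ℂ) x`, in whose coordinates `g_{ij̄}` is
taken; the expression `g_{ij̄}` is the same in each affine chart. -/
def fubiniStudy (x : CP n) (u v : TangentSpace 𝓘(ℂ, Fin n → ℂ) x) : ℂ :=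
  let u' : Fin n → ℂ := u
  let v' : Fin n → ℂ := v
  ∑ i, ∑ j, fubiniStudyCoeff i j (chartAt (Fin n → ℂ) x x) * u' i * (starRingEnd ℂ) (v' j)

/-- `|df|(z) = √2 |df(∂/∂z)|`, the norm of the differential of a holomorphic curve. -/
def normDeriv (f : ℂ → CP n) (z : ℂ) : ℝ :=
  let v : TangentSpace 𝓘(ℂ, Fin n → ℂ) (f z) :=
    mfderiv 𝓘(ℂ, ℂ) 𝓘(ℂ, Fin n → ℂ) f z (1 : ℂ)
  √2 * √(fubiniStudy (f z) v v).re

/-- `𝓜(ℂPⁿ)`: the holomorphic curves `f : ℂ → ℂPⁿ` with `|df| ≤ 1`. -/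
def moduli (n : ℕ) : Set (ℂ → CP n) :=
  {f | MDifferentiable 𝓘(ℂ, ℂ) 𝓘(ℂ, Fin n → ℂ) f ∧ ∀ z, normDeriv f z ≤ 1}

/-- The packing density `ρ(f) = limsup_{R → ∞} (1 / πR²) ∫_{|z| ≤ R} |df|² dx dy`. -/
def packingDensity (f : ℂ → CP n) : ℝ≥0∞ :=
  limsup (fun R : ℝ => (∫⁻ z in Metric.closedBall (0 : ℂ) R, ENNReal.ofReal (normDeriv f z ^ 2)) /
    ENNReal.ofReal (Real.pi * R ^ 2)) atTop

/-- The holomorphic capacity `ρ(ℂPⁿ) = sup_{f ∈ 𝓜(ℂPⁿ)} ρ(f)`. -/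
def capacity (n : ℕ) : ℝ≥0∞ := ⨆ f ∈ moduli n, packingDensity f

end CP

end

/-! Monotonicity holds because the linear embedding `embed` preserves `normDeriv`. The bound
`capacity n ≤ 1` is immediate from `|df| ≤ 1`. What remains is to find curves whose energy density
is almost constant.

The curve has as coordinates the theta functions `F_j(z) = ∑ exp(-π h² m² / 2 + π h m z)`, summed
over `m ≡ j` mod `N = n + 1`. After multiplication by `exp(-π x² / 2)`, `x = Re z`, the term of
index `m` has modulus `exp(-π (h m - x)² / 2)`. For `N` large, two indices in the same class are
never both near `x / h`, so cross terms are negligible and the Hermitian products of `F` and `F'`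
become sums over all integers. For `h` small these are Riemann sums of Gaussian moments, uniformly
in `z` (`exists_thetaMoment_close`). The moments 1, 0, 1/(2π) make the homogeneous energy density
uniformly close to `π² · 1/(2π)`.

Rescaling the variable so that the maximum is at most 1 (`le_capacity`) gives density at least the
ratio of the lower to the upper bound, which tends to 1. -/

namespace CP

/-! ### The Fubini–Study norm in homogeneous coordinates -/

/-- The Fubini–Study norm (up to the factor `1 / π`) of the velocity `b` of a curve in homogeneous
coordinates at the point `a`. -/
noncomputable def homogNormSq {ι : Type*} [Fintype ι] (a b : ι → ℂ) : ℝ :=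
  ((∑ i, ‖a i‖ ^ 2) * (∑ i, ‖b i‖ ^ 2) - ‖∑ i, b i * (starRingEnd ℂ) (a i)‖ ^ 2) /
    (∑ i, ‖a i‖ ^ 2) ^ 2

theorem sum_norm_sq_smul_add {ι : Type*} [Fintype ι] (l m : ℂ) (a b : ι → ℂ) :
    ((∑ i, ‖l * b i + m * a i‖ ^ 2 : ℝ) : ℂ) =
      l * (starRingEnd ℂ) l * ((∑ i, ‖b i‖ ^ 2 : ℝ) : ℂ) +
      l * (starRingEnd ℂ) m * (∑ i, b i * (starRingEnd ℂ) (a i)) +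
      m * (starRingEnd ℂ) l * (starRingEnd ℂ) (∑ i, b i * (starRingEnd ℂ) (a i)) +
      m * (starRingEnd ℂ) m * ((∑ i, ‖a i‖ ^ 2 : ℝ) : ℂ) := by
  push_cast
  simp only [← Complex.mul_conj', map_sum, Finset.mul_sum, ← Finset.sum_add_distrib, map_add,
    map_mul, Complex.conj_conj]
  exact Finset.sum_congr rfl fun i _ => by ring

/-- The numerator is a Gram determinant: adding a multiple of `a` to `b` leaves it unchanged, and
scaling both by `l` multiplies it by `|l|⁴`, as it does the denominator. This is independence of the
lift. Since `l` and `m` are mere numbers at one point, it also allows a non-holomorphic rescaling of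
the lift. -/
theorem homogNormSq_smul_add {ι : Type*} [Fintype ι] (a b : ι → ℂ) {l : ℂ} (hl : l ≠ 0) (m : ℂ) :
    homogNormSq (fun i => l * a i) (fun i => l * b i + m * a i) = homogNormSq a b := by
  have hA : ((∑ i, ‖l * a i‖ ^ 2 : ℝ) : ℂ) =
      l * (starRingEnd ℂ) l * ((∑ i, ‖a i‖ ^ 2 : ℝ) : ℂ) := by
    have := sum_norm_sq_smul_add 0 l a b
    simpa using this
  have hC : ∑ i, (l * b i + m * a i) * (starRingEnd ℂ) (l * a i) =
      l * (starRingEnd ℂ) l * (∑ i, b i * (starRingEnd ℂ) (a i)) +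
      m * (starRingEnd ℂ) l * ((∑ i, ‖a i‖ ^ 2 : ℝ) : ℂ) := by
    push_cast
    simp only [← Complex.mul_conj', Finset.mul_sum, ← Finset.sum_add_distrib, map_mul]
    exact Finset.sum_congr rfl fun i _ => by ring
  have key : (homogNormSq (fun i => l * a i) (fun i => l * b i + m * a i) : ℂ) =
      (homogNormSq a b : ℂ) := by
    unfold homogNormSq
    rw [Complex.ofReal_div, Complex.ofReal_div, Complex.ofReal_sub, Complex.ofReal_sub,
      Complex.ofReal_mul, Complex.ofReal_mul, sum_norm_sq_smul_add, Complex.ofReal_pow,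
      Complex.ofReal_pow, hA, Complex.ofReal_pow, Complex.ofReal_pow,
      ← Complex.mul_conj', ← Complex.mul_conj', hC]
    have hl' : (starRingEnd ℂ) l ≠ 0 := by simpa using hl
    have hc : (l * (starRingEnd ℂ) l) ^ 2 ≠ 0 := pow_ne_zero _ (mul_ne_zero hl hl')
    rw [mul_pow, ← mul_div_mul_left _ (((∑ i, ‖a i‖ ^ 2 : ℝ) : ℂ) ^ 2) hc]
    congr 1
    simp only [map_add, map_mul, Complex.conj_conj, Complex.conj_ofReal]
    ring
  exact_mod_cast key

theorem homogNormSq_smul_right {ι : Type*} [Fintype ι] (a b : ι → ℂ) (l : ℂ) :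
    homogNormSq a (fun i => l * b i) = ‖l‖ ^ 2 * homogNormSq a b := by
  unfold homogNormSq
  simp only [mul_assoc, ← Finset.mul_sum, norm_mul, mul_pow]
  ring

variable {n : ℕ}

theorem homogNormSq_insertNth (i : Fin (n + 1)) (w u : Fin n → ℂ) :
    homogNormSq (i.insertNth (1 : ℂ) w : Fin (n + 1) → ℂ)
        (i.insertNth (0 : ℂ) u : Fin (n + 1) → ℂ) =
      ((1 + ∑ k, ‖w k‖ ^ 2) * (∑ k, ‖u k‖ ^ 2) - ‖∑ k, u k * (starRingEnd ℂ) (w k)‖ ^ 2) /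
        (1 + ∑ k, ‖w k‖ ^ 2) ^ 2 := by
  unfold homogNormSq
  simp [Fin.sum_univ_succAbove _ i]

/-! ### The Fubini–Study coefficients in closed form -/

theorem one_add_sum_pos (w : Fin n → ℂ) : 0 < 1 + ∑ k, ‖w k‖ ^ 2 := by positivity

theorem hasFDerivAt_one_add_sum (w : Fin n → ℂ) :
    ∃ L : (Fin n → ℂ) →L[ℝ] ℝ, HasFDerivAt (fun w : Fin n → ℂ => 1 + ∑ k, ‖w k‖ ^ 2) L w ∧
      ∀ v, L v = ∑ k, 2 * (v k * (starRingEnd ℂ) (w k)).re := by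
  have h : ∀ k ∈ (Finset.univ : Finset (Fin n)), HasFDerivAt (fun w : Fin n → ℂ => ‖w k‖ ^ 2)
      ((2 • innerSL ℝ (w k)).comp
        (ContinuousLinearMap.proj (R := ℝ) (φ := fun _ : Fin n => ℂ) k)) w := fun k _ =>
    HasFDerivAt.comp (g := fun x : ℂ => ‖x‖ ^ 2) w (hasStrictFDerivAt_norm_sq (w k)).hasFDerivAt
      (ContinuousLinearMap.proj (R := ℝ) (φ := fun _ : Fin n => ℂ) k).hasFDerivAt
  refine ⟨_, (HasFDerivAt.fun_sum h).const_add 1, fun v => ?_⟩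
  simp [Complex.inner, mul_add]

theorem wirtingerBar_potential (j : Fin n) (w : Fin n → ℂ) :
    wirtingerBar j potential w = w j / ((1 + ∑ k, ‖w k‖ ^ 2 : ℝ) : ℂ) := by
  obtain ⟨L, hL, hLv⟩ := hasFDerivAt_one_add_sum w
  have h : HasFDerivAt (potential (n := n))
      (Complex.ofRealCLM.comp ((1 + ∑ k, ‖w k‖ ^ 2)⁻¹ • L)) w :=
    Complex.ofRealCLM.hasFDerivAt.comp w (hL.log (one_add_sum_pos w).ne')
  have hs : ∀ c : ℂ, L (Pi.single j c) = 2 * (c * (starRingEnd ℂ) (w j)).re := fun c => by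
    rw [hLv, Finset.sum_eq_single j] <;> simp +contextual
  have h0 : ((1 + ∑ k, ‖w k‖ ^ 2 : ℝ) : ℂ) ≠ 0 := by exact_mod_cast (one_add_sum_pos w).ne'
  unfold wirtingerBar
  rw [h.fderiv]
  simp only [ContinuousLinearMap.comp_apply, smul_apply, hs,
    Complex.ofRealCLM_apply, smul_eq_mul, Complex.ofReal_mul, Complex.ofReal_inv]
  rw [eq_div_iff h0]
  generalize ((1 + ∑ k, ‖w k‖ ^ 2 : ℝ) : ℂ) = S at h0
  field_simp
  apply Complex.ext <;> simp

theorem fubiniStudyCoeff_eq (i j : Fin n) (w : Fin n → ℂ) :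
    fubiniStudyCoeff i j w = 1 / (2 * (Real.pi : ℂ)) *
      ((if i = j then 1 else 0) / ((1 + ∑ k, ‖w k‖ ^ 2 : ℝ) : ℂ) -
        w j * (starRingEnd ℂ) (w i) / ((1 + ∑ k, ‖w k‖ ^ 2 : ℝ) : ℂ) ^ 2) := by
  obtain ⟨L, hL, hLv⟩ := hasFDerivAt_one_add_sum w
  have h0 : ((1 + ∑ k, ‖w k‖ ^ 2 : ℝ) : ℂ) ≠ 0 := by exact_mod_cast (one_add_sum_pos w).ne'
  have hfun : wirtingerBar j (potential (n := n)) =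
      fun w => w j * (((1 + ∑ k, ‖w k‖ ^ 2)⁻¹ : ℝ) : ℂ) := by
    funext w
    rw [wirtingerBar_potential, div_eq_mul_inv, Complex.ofReal_inv]
  have hr : HasFDerivAt (fun w : Fin n → ℂ => (1 + ∑ k, ‖w k‖ ^ 2)⁻¹)
      (-((1 + ∑ k, ‖w k‖ ^ 2) ^ 2)⁻¹ • L) w :=
    (hasDerivAt_inv (one_add_sum_pos w).ne').comp_hasFDerivAt w hL
  have hp : HasFDerivAt (fun w : Fin n → ℂ => w j)
      (ContinuousLinearMap.proj (R := ℝ) (φ := fun _ : Fin n => ℂ) j) w :=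
    (ContinuousLinearMap.proj (R := ℝ) (φ := fun _ : Fin n => ℂ) j).hasFDerivAt
  have hq : HasFDerivAt (fun w : Fin n → ℂ => (((1 + ∑ k, ‖w k‖ ^ 2)⁻¹ : ℝ) : ℂ))
      (Complex.ofRealCLM.comp (-((1 + ∑ k, ‖w k‖ ^ 2) ^ 2)⁻¹ • L)) w :=
    Complex.ofRealCLM.hasFDerivAt.comp w hr
  have h := hp.fun_mul hq
  rw [← hfun] at h
  have hs : ∀ c : ℂ, L (Pi.single i c) = 2 * (c * (starRingEnd ℂ) (w i)).re := fun c => by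
    rw [hLv, Finset.sum_eq_single i] <;> simp +contextual
  unfold fubiniStudyCoeff wirtinger
  congr 1
  rw [h.fderiv]
  simp only [ContinuousLinearMap.comp_apply, smul_apply, hs,
    Complex.ofRealCLM_apply, smul_eq_mul, Complex.ofReal_mul, Complex.ofReal_inv,
    add_apply, ContinuousLinearMap.proj_apply,
    Complex.ofReal_neg, Complex.ofReal_pow, Pi.single_apply]
  generalize ((1 + ∑ k, ‖w k‖ ^ 2 : ℝ) : ℂ) = S at h0
  have e : (starRingEnd ℂ) (w i) = ((w i).re : ℂ) - Complex.I * ((w i).im : ℂ) := by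
    apply Complex.ext <;> simp
  have e1 : (1 * (starRingEnd ℂ) (w i)).re = (w i).re := by simp
  have e2 : (Complex.I * (starRingEnd ℂ) (w i)).re = (w i).im := by simp
  rw [e1, e2, e]
  by_cases hij : i = j
  · subst hij
    simp only [if_true]
    field_simp
    push_cast
    linear_combination (-S) * Complex.I_sq
  · simp only [hij, Ne.symm hij, if_false]
    field_simp
    push_cast
    ring

theorem sum_fubiniStudyCoeff (w u : Fin n → ℂ) :
    (∑ i, ∑ j, fubiniStudyCoeff i j w * u i * (starRingEnd ℂ) (u j)).re =
      1 / (2 * Real.pi) * (((1 + ∑ k, ‖w k‖ ^ 2) * (∑ k, ‖u k‖ ^ 2) -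
        ‖∑ k, u k * (starRingEnd ℂ) (w k)‖ ^ 2) / (1 + ∑ k, ‖w k‖ ^ 2) ^ 2) := by
  have h0 : ((1 + ∑ k, ‖w k‖ ^ 2 : ℝ) : ℂ) ≠ 0 := by exact_mod_cast (one_add_sum_pos w).ne'
  have key : ∑ i, ∑ j, fubiniStudyCoeff i j w * u i * (starRingEnd ℂ) (u j) =
      ((1 / (2 * Real.pi) * (((1 + ∑ k, ‖w k‖ ^ 2) * (∑ k, ‖u k‖ ^ 2) -
        ‖∑ k, u k * (starRingEnd ℂ) (w k)‖ ^ 2) / (1 + ∑ k, ‖w k‖ ^ 2) ^ 2) : ℝ) : ℂ) := by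
    have h1 : ∑ i, ∑ j, (if i = j then (1 : ℂ) else 0) * u i * (starRingEnd ℂ) (u j) =
        ((∑ k, ‖u k‖ ^ 2 : ℝ) : ℂ) := by
      push_cast
      simp [← Complex.mul_conj']
    have h2 : ∑ i, ∑ j, (w j * (starRingEnd ℂ) (w i)) * u i * (starRingEnd ℂ) (u j) =
        ((‖∑ k, u k * (starRingEnd ℂ) (w k)‖ ^ 2 : ℝ) : ℂ) := by
      rw [Complex.ofReal_pow, ← Complex.mul_conj', map_sum, Finset.sum_mul_sum]
      refine Finset.sum_congr rfl fun i _ => Finset.sum_congr rfl fun j _ => ?_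
      simp only [map_mul, Complex.conj_conj]
      ring
    have e : ∀ S A C : ℝ, ((1 / (2 * Real.pi) * ((S * A - C) / S ^ 2) : ℝ) : ℂ) =
        1 / (2 * (Real.pi : ℂ)) * (((S : ℂ) * (A : ℂ) - (C : ℂ)) / (S : ℂ) ^ 2) := by
      intro S A C; push_cast; rfl
    rw [e, ← h1, ← h2]
    simp only [fubiniStudyCoeff_eq]
    generalize ((1 + ∑ k, ‖w k‖ ^ 2 : ℝ) : ℂ) = S at h0
    rw [sub_div, Finset.mul_sum, Finset.sum_div, Finset.sum_div, ← Finset.sum_sub_distrib,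
      Finset.mul_sum]
    refine Finset.sum_congr rfl fun i _ => ?_
    rw [Finset.mul_sum, Finset.sum_div, Finset.sum_div, ← Finset.sum_sub_distrib, Finset.mul_sum]
    refine Finset.sum_congr rfl fun j _ => ?_
    field_simp
  rw [key, Complex.ofReal_re]

end CP

namespace CP

variable {n : ℕ}

/-! ### Local lifts and the norm of the differential -/

/-- The curve `f` is given near `z` by the homogeneous coordinates `F`. -/
def IsLiftAt (F : ℂ → Fin (n + 1) → ℂ) (f : ℂ → CP n) (z : ℂ) : Prop :=
  ∀ᶠ y in 𝓝 z, ∃ h : F y ≠ 0, f y = proj ⟨F y, h⟩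

theorem IsLiftAt.continuousAt {F : ℂ → Fin (n + 1) → ℂ} {f : ℂ → CP n} {z : ℂ}
    (h : IsLiftAt F f z) (hF : ContinuousAt F z) : ContinuousAt f z := by
  obtain ⟨h0, -⟩ := h.self_of_nhds
  classical
  -- Where `F` vanishes, `G` takes the arbitrary value `F z`; near `z` this does not occur.
  let G : ℂ → Homog n := fun y => if hy : F y ≠ 0 then ⟨F y, hy⟩ else ⟨F z, h0⟩
  have hG : ContinuousAt G z := by
    refine (Topology.IsInducing.subtypeVal (t := {v : Fin (n + 1) → ℂ | v ≠ 0})).continuousAt_iff.2 ?_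
    refine hF.congr (h.mono fun y hy => ?_)
    obtain ⟨h1, -⟩ := hy
    simp [G, h1]
  refine (isQuotientMap_proj.continuous.continuousAt.comp hG).congr (h.mono fun y hy => ?_)
  obtain ⟨h1, h2⟩ := hy
  simp [G, h1, h2]

theorem extChartAt_eq (x : CP n) : ∃ i : Fin (n + 1), x ∈ affineOpen i ∧
    chartAt (Fin n → ℂ) x = affineChart i :=
  ⟨(exists_mem_affineOpen x).choose, (exists_mem_affineOpen x).choose_spec, rfl⟩

theorem writtenInExtChartAt_eq {f : ℂ → CP n} {z : ℂ} {i : Fin (n + 1)}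
    (hi : chartAt (Fin n → ℂ) (f z) = affineChart i) :
    writtenInExtChartAt 𝓘(ℂ, ℂ) 𝓘(ℂ, Fin n → ℂ) z f = fun y => affineCoord i (f y) := by
  funext y
  simp [writtenInExtChartAt, hi, affineChart]
  rfl

theorem normDeriv_eq {f : ℂ → CP n} {z : ℂ} {i : Fin (n + 1)}
    (hi : chartAt (Fin n → ℂ) (f z) = affineChart i) {u : Fin n → ℂ} (hf : ContinuousAt f z)
    (hu : HasDerivAt (fun y => affineCoord i (f y)) u z) :
    MDifferentiableAt 𝓘(ℂ, ℂ) 𝓘(ℂ, Fin n → ℂ) f z ∧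
    normDeriv f z ^ 2 = 1 / Real.pi * homogNormSq
      (i.insertNth (1 : ℂ) (affineCoord i (f z)) : Fin (n + 1) → ℂ)
      (i.insertNth (0 : ℂ) u : Fin (n + 1) → ℂ) := by
  have hd : MDifferentiableAt 𝓘(ℂ, ℂ) 𝓘(ℂ, Fin n → ℂ) f z := by
    rw [mdifferentiableAt_iff]
    refine ⟨hf, ?_⟩
    rw [writtenInExtChartAt_eq hi]
    exact hu.differentiableAt.differentiableWithinAt
  refine ⟨hd, ?_⟩
  have hm : mfderiv 𝓘(ℂ, ℂ) 𝓘(ℂ, Fin n → ℂ) f z (1 : ℂ) = u := by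
    rw [hd.mfderiv, writtenInExtChartAt_eq hi]
    have : fderivWithin ℂ (fun y => affineCoord i (f y)) (Set.range 𝓘(ℂ, ℂ))
        (extChartAt 𝓘(ℂ, ℂ) z z) 1 = u := by
      simp [fderivWithin_univ]
      exact hu.deriv
    exact this
  have hn : normDeriv f z = √2 * √(∑ i', ∑ j, fubiniStudyCoeff i' j (affineCoord i (f z)) *
      u i' * (starRingEnd ℂ) (u j)).re := by
    unfold normDeriv fubiniStudy
    simp only [hm, hi]
    rfl
  -- Cauchy–Schwarz: the quantity under the square root in `normDeriv` is nonnegative, so squaring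
  -- undoes the root.
  have hcs : (0 : ℝ) ≤ (1 + ∑ k, ‖affineCoord i (f z) k‖ ^ 2) * (∑ k, ‖u k‖ ^ 2) -
        ‖∑ k, u k * (starRingEnd ℂ) (affineCoord i (f z) k)‖ ^ 2 := by
    set w := affineCoord i (f z)
    have h1 : ‖∑ k, u k * (starRingEnd ℂ) (w k)‖ ^ 2 ≤ (∑ k, ‖u k‖ * ‖w k‖) ^ 2 := by
      gcongr
      refine (norm_sum_le _ _).trans (le_of_eq ?_)
      simp
    have h2 := Finset.sum_mul_sq_le_sq_mul_sq Finset.univ (fun k => ‖u k‖) (fun k => ‖w k‖)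
    have h3 : 0 ≤ ∑ k, ‖u k‖ ^ 2 := by positivity
    nlinarith
  rw [hn, sum_fubiniStudyCoeff, homogNormSq_insertNth, mul_pow, Real.sq_sqrt (by norm_num),
    Real.sq_sqrt]
  · field_simp
  · positivity

/-- The Fubini–Study norm of the derivative in homogeneous coordinates. -/
theorem IsLiftAt.normDeriv_sq {F : ℂ → Fin (n + 1) → ℂ} {f : ℂ → CP n} {z : ℂ}
    (h : IsLiftAt F f z) {F' : Fin (n + 1) → ℂ} (hF : HasDerivAt F F' z) :
    MDifferentiableAt 𝓘(ℂ, ℂ) 𝓘(ℂ, Fin n → ℂ) f z ∧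
      normDeriv f z ^ 2 = 1 / Real.pi * homogNormSq (F z) F' := by
  obtain ⟨i, hmem, hi⟩ := extChartAt_eq (f z)
  obtain ⟨h0, hfz⟩ := h.self_of_nhds
  have hFi : F z i ≠ 0 := by rwa [hfz, proj_mem_affineOpen] at hmem
  have hFc := hasDerivAt_pi.1 hF
  have hu : HasDerivAt (fun y => affineCoord i (f y))
      (fun k => (F' (i.succAbove k) * F z i - F z (i.succAbove k) * F' i) / F z i ^ 2) z := by
    refine (hasDerivAt_pi.2 fun k => (hFc (i.succAbove k)).div (hFc i) hFi).congr_of_eventuallyEq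
      (h.mono fun y hy => ?_)
    obtain ⟨h1, h2⟩ := hy
    simp only [h2, affineCoord_proj]
    rfl
  obtain ⟨h1, h2⟩ := normDeriv_eq hi (h.continuousAt hF.continuousAt) hu
  refine ⟨h1, ?_⟩
  -- The lift `F` is `F_i` times the affine lift; by the product rule its velocity is `F_i` times
  -- the affine velocity plus `F_i'` times the affine lift.
  rw [h2, ← homogNormSq_smul_add _ _ hFi (F' i)]
  congr 2
  · funext k
    refine Fin.succAboveCases i ?_ (fun k => ?_) k
    · simp
    · simp only [Fin.insertNth_apply_succAbove, hfz, affineCoord_proj]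
      field_simp
  · funext k
    refine Fin.succAboveCases i ?_ (fun k => ?_) k
    · simp
    · simp only [Fin.insertNth_apply_succAbove, hfz, affineCoord_proj]
      field_simp
      ring

theorem exists_isLiftAt {f : ℂ → CP n} {z : ℂ}
    (hf : MDifferentiableAt 𝓘(ℂ, ℂ) 𝓘(ℂ, Fin n → ℂ) f z) :
    ∃ (F : ℂ → Fin (n + 1) → ℂ) (F' : Fin (n + 1) → ℂ), IsLiftAt F f z ∧ HasDerivAt F F' z := by
  obtain ⟨i, hmem, hi⟩ := extChartAt_eq (f z)
  obtain ⟨hc, hd⟩ := (mdifferentiableAt_iff f z).1 hf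
  rw [writtenInExtChartAt_eq hi] at hd
  simp only [modelWithCornersSelf_coe, Set.range_id, differentiableWithinAt_univ,
    extChartAt_self_apply] at hd
  have hu := hasDerivAt_pi.1 hd.hasDerivAt
  refine ⟨fun y => i.insertNth (1 : ℂ) (affineCoord i (f y)), i.insertNth (0 : ℂ)
    (deriv (fun y => affineCoord i (f y)) z), ?_, ?_⟩
  · filter_upwards [hc.preimage_mem_nhds ((isOpen_affineOpen i).mem_nhds hmem)] with y hy
    exact ⟨insertNth_one_ne_zero i _, (affineInv_affineCoord i _ hy).symm⟩
  · refine hasDerivAt_pi.2 fun k => ?_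
    refine Fin.succAboveCases i ?_ (fun k => ?_) k
    · simpa using hasDerivAt_const z (1 : ℂ)
    · simpa using hu k

/-! ### Monotonicity in the dimension -/

/-- The linear embedding `(z₀, …, zₙ) ↦ (z₀, …, zₙ, 0)`. -/
noncomputable def snocZero (n : ℕ) : (Fin (n + 1) → ℂ) →ₗ[ℂ] (Fin (n + 2) → ℂ) where
  toFun v := Fin.snoc v 0
  map_add' v w := by
    funext k
    refine Fin.lastCases ?_ (fun k => ?_) k <;> simp
  map_smul' c v := by
    funext k
    refine Fin.lastCases ?_ (fun k => ?_) k <;> simp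

theorem snocZero_last (v : Fin (n + 1) → ℂ) : snocZero n v (Fin.last _) = 0 := by
  simp [snocZero]

theorem snocZero_castSucc (v : Fin (n + 1) → ℂ) (k : Fin (n + 1)) :
    snocZero n v k.castSucc = v k := by
  simp [snocZero]

theorem snocZero_injective (n : ℕ) : Function.Injective (snocZero n) := fun v w h => by
  funext k
  rw [← snocZero_castSucc v, h, snocZero_castSucc]

theorem homogNormSq_snocZero (a b : Fin (n + 1) → ℂ) :
    homogNormSq (snocZero n a) (snocZero n b) = homogNormSq a b := by
  unfold homogNormSq
  simp [Fin.sum_univ_castSucc (n := n + 1), snocZero_castSucc, snocZero_last]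

/-- The linear embedding `ℂPⁿ → ℂPⁿ⁺¹`. -/
noncomputable def embed (n : ℕ) : CP n → CP (n + 1) := Projectivization.map (snocZero n) (snocZero_injective n)

theorem IsLiftAt.embed {F : ℂ → Fin (n + 1) → ℂ} {f : ℂ → CP n} {z : ℂ} (h : IsLiftAt F f z) :
    IsLiftAt (fun y => snocZero n (F y)) (fun y => CP.embed n (f y)) z := by
  refine h.mono fun y hy => ?_
  obtain ⟨h1, h2⟩ := hy
  refine ⟨(map_ne_zero_iff _ (snocZero_injective n)).2 h1, ?_⟩
  change CP.embed n (f y) = _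
  rw [h2]
  rfl

theorem hasDerivAt_snocZero {F : ℂ → Fin (n + 1) → ℂ} {F' : Fin (n + 1) → ℂ} {z : ℂ}
    (h : HasDerivAt F F' z) : HasDerivAt (fun y => snocZero n (F y)) (snocZero n F') z :=
  ((snocZero n).toContinuousLinearMap.hasFDerivAt (x := F z)).comp_hasDerivAt z h

theorem normDeriv_nonneg (f : ℂ → CP n) (z : ℂ) : 0 ≤ normDeriv f z := by
  unfold normDeriv
  positivity

theorem embed_mem_moduli {f : ℂ → CP n} (hf : f ∈ moduli n) :
    (fun y => embed n (f y)) ∈ moduli (n + 1) ∧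
      ∀ z, normDeriv (fun y => embed n (f y)) z = normDeriv f z := by
  have key : ∀ z, MDifferentiableAt 𝓘(ℂ, ℂ) 𝓘(ℂ, Fin (n + 1) → ℂ) (fun y => embed n (f y)) z ∧
      normDeriv (fun y => embed n (f y)) z = normDeriv f z := fun z => by
    obtain ⟨F, F', hF, hF'⟩ := exists_isLiftAt (hf.1 z)
    obtain ⟨h1, h2⟩ := hF.embed.normDeriv_sq (hasDerivAt_snocZero hF')
    refine ⟨h1, ?_⟩
    rw [homogNormSq_snocZero, ← (hF.normDeriv_sq hF').2] at h2
    exact (pow_left_inj₀ (normDeriv_nonneg _ _) (normDeriv_nonneg _ _) two_ne_zero).1 h2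
  exact ⟨⟨fun z => (key z).1, fun z => (key z).2 ▸ hf.2 z⟩, fun z => (key z).2⟩

theorem capacity_le_capacity_succ (n : ℕ) : capacity n ≤ capacity (n + 1) := by
  refine iSup₂_le fun f hf => ?_
  obtain ⟨h1, h2⟩ := embed_mem_moduli hf
  have : packingDensity f = packingDensity (fun y => embed n (f y)) := by
    simp only [packingDensity, h2]
  rw [this]
  exact le_iSup₂ (f := fun f (_ : f ∈ moduli (n + 1)) => packingDensity f) _ h1

/-! ### Pointwise energy bounds and the capacity -/

theorem volume_closedBall_eq (R : ℝ) (hR : 0 < R) :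
    volume (Metric.closedBall (0 : ℂ) R) = ENNReal.ofReal (Real.pi * R ^ 2) := by
  rw [Complex.volume_closedBall, ENNReal.ofReal_mul Real.pi_pos.le, ENNReal.ofReal_pow hR.le,
    mul_comm, ← NNReal.coe_real_pi, ENNReal.ofReal_coe_nnreal]

theorem packingDensity_le {f : ℂ → CP n} {c : ℝ} (h : ∀ z, normDeriv f z ^ 2 ≤ c) :
    packingDensity f ≤ ENNReal.ofReal c := by
  refine limsup_le_of_le (by isBoundedDefault) ?_
  filter_upwards [eventually_gt_atTop 0] with R hR
  refine ENNReal.div_le_of_le_mul ?_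
  rw [← volume_closedBall_eq R hR, ← setLIntegral_const]
  exact lintegral_mono fun z => ENNReal.ofReal_le_ofReal (h z)

theorem le_packingDensity {f : ℂ → CP n} {c : ℝ} (h : ∀ z, c ≤ normDeriv f z ^ 2) :
    ENNReal.ofReal c ≤ packingDensity f := by
  refine le_limsup_of_frequently_le (Eventually.frequently ?_) (by isBoundedDefault)
  filter_upwards [eventually_gt_atTop 0] with R hR
  have hp : 0 < Real.pi * R ^ 2 := by positivity
  rw [ENNReal.le_div_iff_mul_le (Or.inl (by simpa using hp)) (Or.inl ENNReal.ofReal_ne_top),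
    ← volume_closedBall_eq R hR, ← setLIntegral_const]
  exact lintegral_mono fun z => ENNReal.ofReal_le_ofReal (h z)

theorem capacity_le_one (n : ℕ) : capacity n ≤ 1 := by
  refine iSup₂_le fun f hf => ?_
  rw [← ENNReal.ofReal_one]
  exact packingDensity_le fun z => pow_le_one₀ (normDeriv_nonneg f z) (hf.2 z)

/-- A curve without base points whose velocity is between `a` and `b` bounds the capacity. -/
theorem le_capacity {F F' : ℂ → Fin (n + 1) → ℂ} (h0 : ∀ z, F z ≠ 0)
    (hF : ∀ z, HasDerivAt F (F' z) z) {a b : ℝ} (hb : 0 < b)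
    (ha : ∀ z, a ≤ homogNormSq (F z) (F' z)) (hb' : ∀ z, homogNormSq (F z) (F' z) ≤ b) :
    ENNReal.ofReal (a / b) ≤ capacity n := by
  -- The substitution `z ↦ l z` multiplies the energy by `l² = π / b`; with the factor `1 / π` of
  -- `normDeriv_sq` this makes it `homogNormSq / b ≤ 1`.
  set l : ℝ := √(Real.pi / b)
  have hl : l ^ 2 = Real.pi / b := Real.sq_sqrt (by positivity)
  let f : ℂ → CP n := fun z => proj ⟨F (l * z), h0 _⟩
  have hlift : ∀ z, IsLiftAt (fun y => F (l * y)) f z := fun z =>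
    Eventually.of_forall fun y => ⟨h0 _, rfl⟩
  have hd : ∀ z, HasDerivAt (fun y : ℂ => F (l * y)) ((l : ℂ) • F' (l * z)) z := fun z => by
    have h1 : HasDerivAt (fun y : ℂ => (l : ℂ) * y) (l : ℂ) z := by
      simpa using (hasDerivAt_id z).const_mul (l : ℂ)
    exact HasDerivAt.scomp z (hF (l * z)) h1
  have hn : ∀ z, normDeriv f z ^ 2 = homogNormSq (F (l * z)) (F' (l * z)) / b := fun z => by
    rw [((hlift z).normDeriv_sq (hd z)).2]
    have := homogNormSq_smul_right (F (l * z)) (F' (l * z)) (l : ℂ)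
    rw [show ((l : ℂ) • F' (l * z)) = fun i => (l : ℂ) * F' (l * z) i from rfl, this,
      Complex.norm_real, Real.norm_eq_abs, sq_abs, hl]
    field_simp
  have hf : f ∈ moduli n := by
    refine ⟨fun z => ((hlift z).normDeriv_sq (hd z)).1, fun z => ?_⟩
    rw [← pow_le_one_iff_of_nonneg (normDeriv_nonneg f z) two_ne_zero, hn, div_le_one hb]
    exact hb' _
  refine le_trans (le_packingDensity fun z => ?_)
    (le_iSup₂ (f := fun f (_ : f ∈ moduli n) => packingDensity f) f hf)
  rw [hn]
  gcongr
  exact ha _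

end CP

/-! ### Riemann sums over the integers and Gaussian moments -/

theorem norm_sub_intervalIntegral_le {g g' : ℝ → ℝ} (hd : ∀ x, HasDerivAt g (g' x) x)
    (hg' : Integrable g') (hg : Integrable g) (a : ℝ) :
    ‖g a - ∫ x in a..a + 1, g x‖ ≤ ∫ x in a..a + 1, ‖g' x‖ := by
  have hii : ∀ b c, IntervalIntegrable g' volume b c := fun b c => hg'.intervalIntegrable
  have hin : ∀ b c, IntervalIntegrable (fun x => ‖g' x‖) volume b c :=
    fun b c => hg'.norm.intervalIntegrable
  have h1 : g a - ∫ x in a..a + 1, g x = ∫ x in a..a + 1, (g a - g x) := by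
    rw [intervalIntegral.integral_sub intervalIntegrable_const hg.intervalIntegrable]
    simp
  rw [h1]
  refine (intervalIntegral.norm_integral_le_of_norm_le_const (C := ∫ x in a..a + 1, ‖g' x‖)
    fun x hx => ?_).trans (by simp)
  rw [Set.uIoc_of_le (by linarith)] at hx
  rw [norm_sub_rev, ← intervalIntegral.integral_eq_sub_of_hasDerivAt (fun y _ => hd y) (hii a x)]
  refine (intervalIntegral.norm_integral_le_integral_norm hx.1.le).trans ?_
  exact intervalIntegral.integral_mono_interval le_rfl hx.1.le hx.2
    (Eventually.of_forall fun y => norm_nonneg _) (hin _ _)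

/-- The sum of a function over the integers differs from its integral by at most its total
variation. -/
theorem norm_tsum_int_sub_integral_le {g g' : ℝ → ℝ} (hd : ∀ x, HasDerivAt g (g' x) x)
    (hg' : Integrable g') (hg : Integrable g) :
    Summable (fun m : ℤ => g m) ∧ ‖∑' m : ℤ, g m - ∫ x, g x‖ ≤ ∫ x, ‖g' x‖ := by
  have h1 : HasSum (fun m : ℤ => ∫ x in (m : ℝ)..m + 1, g x) (∫ x, g x) := by
    simpa using hg.hasSum_intervalIntegral 0
  have h2 : HasSum (fun m : ℤ => ∫ x in (m : ℝ)..m + 1, ‖g' x‖) (∫ x, ‖g' x‖) := by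
    simpa using hg'.norm.hasSum_intervalIntegral 0
  have hb := fun m : ℤ => norm_sub_intervalIntegral_le hd hg' hg (m : ℝ)
  have h3 : Summable fun m : ℤ => g m - ∫ x in (m : ℝ)..m + 1, g x :=
    Summable.of_norm_bounded h2.summable hb
  have h4 : Summable fun m : ℤ => g m := by simpa using h3.add h1.summable
  refine ⟨h4, ?_⟩
  rw [← h1.tsum_eq, ← h4.tsum_sub h1.summable]
  exact tsum_of_norm_bounded h2 hb

/-- Total variation is invariant under `x ↦ h x - c`, while the integral is divided by `h`. The
error bound does not depend on the shift `c`, which later is `Re z`. -/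
theorem norm_riemannSum_sub_integral_le {g g' : ℝ → ℝ} (hd : ∀ x, HasDerivAt g (g' x) x)
    (hg' : Integrable g') (hg : Integrable g) {h : ℝ} (hh : 0 < h) (c : ℝ) :
    Summable (fun m : ℤ => g (h * m - c)) ∧
      ‖h * ∑' m : ℤ, g (h * m - c) - ∫ x, g x‖ ≤ h * ∫ x, ‖g' x‖ := by
  have hd' : ∀ x, HasDerivAt (fun x => g (h * x - c)) (h * g' (h * x - c)) x := fun x => by
    have h1 : HasDerivAt (fun x : ℝ => h * x - c) h x := by
      simpa using ((hasDerivAt_id x).const_mul h).sub_const c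
    have h2 := HasDerivAt.comp x (hd (h * x - c)) h1
    rw [mul_comm] at h2
    exact h2
  have hint : ∀ {f : ℝ → ℝ}, Integrable f → Integrable fun x => f (h * x - c) := fun hf =>
    (hf.comp_sub_right c).comp_mul_left' hh.ne'
  have heq : ∀ f : ℝ → ℝ, ∫ x, f (h * x - c) = h⁻¹ * ∫ x, f x := fun f => by
    rw [Measure.integral_comp_mul_left (fun x => f (x - c)) h, integral_sub_right_eq_self,
      abs_of_pos (inv_pos.2 hh), smul_eq_mul]
  obtain ⟨h1, h2⟩ := norm_tsum_int_sub_integral_le hd' ((hint hg').const_mul h) (hint hg)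
  refine ⟨h1, ?_⟩
  have h3 : ∫ x, ‖h * g' (h * x - c)‖ = ∫ x, ‖g' x‖ := by
    simp only [norm_mul, integral_const_mul]
    rw [heq fun x => ‖g' x‖, Real.norm_of_nonneg hh.le]
    field_simp
  rw [heq, h3] at h2
  have h4 : h * ∑' m : ℤ, g (h * m - c) - ∫ x, g x =
      h * (∑' m : ℤ, g (h * m - c) - h⁻¹ * ∫ x, g x) := by field_simp
  rw [h4, norm_mul, Real.norm_of_nonneg hh.le]
  gcongr

theorem integrable_pow_mul_exp_neg_mul_sq {b : ℝ} (hb : 0 < b) (k : ℕ) :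
    Integrable fun x : ℝ => x ^ k * Real.exp (-b * x ^ 2) := by
  have := integrable_rpow_mul_exp_neg_mul_sq hb (s := k)
    (lt_of_lt_of_le (by norm_num) (Nat.cast_nonneg k))
  simpa using this

theorem hasDerivAt_pow_mul_exp_neg_mul_sq (b : ℝ) (k : ℕ) (x : ℝ) :
    HasDerivAt (fun x : ℝ => x ^ k * Real.exp (-b * x ^ 2))
      (k * (x ^ (k - 1) * Real.exp (-b * x ^ 2)) +
        -2 * b * (x ^ (k + 1) * Real.exp (-b * x ^ 2))) x := by
  have h1 : HasDerivAt (fun x : ℝ => -b * x ^ 2) (-b * (2 * x)) x := by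
    simpa using (hasDerivAt_pow 2 x).const_mul (-b)
  exact ((hasDerivAt_pow k x).fun_mul h1.exp).congr_deriv (by ring)

theorem exists_riemannSum_gaussian_bound {b : ℝ} (hb : 0 < b) (k : ℕ) :
    ∃ C : ℝ, 0 ≤ C ∧ ∀ h : ℝ, 0 < h → ∀ c : ℝ,
      Summable (fun m : ℤ => (h * m - c) ^ k * Real.exp (-b * (h * m - c) ^ 2)) ∧
      ‖h * ∑' m : ℤ, (h * m - c) ^ k * Real.exp (-b * (h * m - c) ^ 2) -
        ∫ x, x ^ k * Real.exp (-b * x ^ 2)‖ ≤ h * C :=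
  ⟨_, integral_nonneg fun _ => norm_nonneg _, fun _ hh c =>
    norm_riemannSum_sub_integral_le (hasDerivAt_pow_mul_exp_neg_mul_sq b k)
    (((integrable_pow_mul_exp_neg_mul_sq hb (k - 1)).const_mul _).add
      ((integrable_pow_mul_exp_neg_mul_sq hb (k + 1)).const_mul _))
    (integrable_pow_mul_exp_neg_mul_sq hb k) hh c⟩

theorem integral_pow_mul_gaussian_zero :
    ∫ x : ℝ, x ^ 0 * Real.exp (-Real.pi * x ^ 2) = 1 := by
  simpa using integral_gaussian Real.pi

/-- The derivative of `x ^ k * exp (-π x²)` has integral zero. For `k = 0` the truncated exponent `k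
- 1` is harmless, its coefficient being 0, and the first moment vanishes. -/
theorem integral_pow_mul_gaussian_succ (k : ℕ) :
    ∫ x : ℝ, x ^ (k + 1) * Real.exp (-Real.pi * x ^ 2) =
      k / (2 * Real.pi) * ∫ x : ℝ, x ^ (k - 1) * Real.exp (-Real.pi * x ^ 2) := by
  have hi := integrable_pow_mul_exp_neg_mul_sq Real.pi_pos
  have := integral_eq_zero_of_hasDerivAt_of_integrable
    (hasDerivAt_pow_mul_exp_neg_mul_sq Real.pi k)
    (((hi (k - 1)).const_mul _).add ((hi (k + 1)).const_mul _)) (hi k)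
  rw [integral_add ((hi (k - 1)).const_mul _) ((hi (k + 1)).const_mul _), integral_const_mul,
    integral_const_mul] at this
  rw [div_mul_eq_mul_div, eq_div_iff (by positivity)]
  linarith

/-! ### Cross terms within residue classes -/

/-- The difference is the off-diagonal double sum, whose terms are at most `(r k * r l)²`. One
factor `r k * r l` supplies `δ`, the other keeps the sum convergent; hence the squares in the
hypotheses. -/
theorem norm_tsum_mul_tsum_sub_le {α β : ℤ → ℂ} {r : ℤ → ℝ} {δ : ℝ} (hr : Summable r)
    (hr0 : ∀ k, 0 ≤ r k) (hr1 : ∀ k, r k ≤ 1) (hα : ∀ k, ‖α k‖ ≤ r k ^ 2)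
    (hβ : ∀ k, ‖β k‖ ≤ r k ^ 2) (hδ0 : 0 ≤ δ) (hδ : ∀ k l, k ≠ l → r k * r l ≤ δ) :
    ‖(∑' k, α k) * (∑' k, β k) - ∑' k, α k * β k‖ ≤ δ * (∑' k, r k) ^ 2 := by
  have hsq : ∀ k, r k ^ 2 ≤ r k := fun k => by nlinarith [hr0 k, hr1 k]
  have hsα : Summable α := Summable.of_norm_bounded hr fun k => (hα k).trans (hsq k)
  have hsβ : Summable β := Summable.of_norm_bounded hr fun k => (hβ k).trans (hsq k)
  have hsαβ : Summable fun k => α k * β k := by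
    refine Summable.of_norm_bounded hr fun k => ?_
    rw [norm_mul]
    nlinarith [(hα k).trans (hsq k), (hβ k).trans (hsq k), hr0 k, hr1 k, norm_nonneg (α k),
      norm_nonneg (β k)]
  rw [← tsum_mul_right, ← (hsα.mul_right _).tsum_sub hsαβ]
  have key : ∀ k, ‖α k * ∑' l, β l - α k * β k‖ ≤ r k * (δ * ∑' l, r l) := fun k => by
    have h1 : ∑' l, β l - β k = ∑' l, if l = k then 0 else β l := by
      rw [hsβ.tsum_eq_add_tsum_ite k]
      ring
    rw [← mul_sub, h1, ← tsum_mul_left, ← mul_assoc, ← tsum_mul_left]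
    refine tsum_of_norm_bounded (hr.mul_left (r k * δ)).hasSum fun l => ?_
    split_ifs with hl
    · simpa using mul_nonneg (mul_nonneg (hr0 k) hδ0) (hr0 l)
    · rw [norm_mul]
      calc ‖α k‖ * ‖β l‖ ≤ r k ^ 2 * r l ^ 2 := by
            gcongr
            exacts [hα k, hβ l]
        _ = (r k * r l) * (r k * r l) := by ring
        _ ≤ δ * (r k * r l) := by
            gcongr
            · exact mul_nonneg (hr0 k) (hr0 l)
            · exact hδ k l (Ne.symm hl)
        _ = r k * δ * r l := by ring
  refine (tsum_of_norm_bounded (hr.mul_right _).hasSum key).trans (le_of_eq ?_)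
  rw [tsum_mul_right]
  ring

/-- Cross terms between congruent integers are negligible when the modulus is large. -/
theorem norm_sum_residue_sub_le {α β : ℤ → ℂ} {r : ℤ → ℝ} {δ : ℝ} (N : ℕ) [NeZero N]
    (hr : Summable r) (hr0 : ∀ k, 0 ≤ r k) (hr1 : ∀ k, r k ≤ 1) (hα : ∀ k, ‖α k‖ ≤ r k ^ 2)
    (hβ : ∀ k, ‖β k‖ ≤ r k ^ 2) (hδ0 : 0 ≤ δ)
    (hδ : ∀ k l : ℤ, (N : ℤ) ≤ |k - l| → r k * r l ≤ δ) :
    ‖∑ j : Fin N, (∑' k : ℤ, α (k * N + j)) * (∑' k : ℤ, β (k * N + j)) - ∑' m, α m * β m‖ ≤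
      N * (δ * (∑' k, r k) ^ 2) := by
  have hN : (0 : ℤ) < N := by exact_mod_cast Nat.pos_of_ne_zero (NeZero.ne N)
  have hinj : ∀ j : Fin N, Function.Injective fun k : ℤ => k * N + (j : ℤ) := fun j k l hkl => by
    simpa [NeZero.ne N] using hkl
  have hsq : ∀ k, r k ^ 2 ≤ r k := fun k => by nlinarith [hr0 k, hr1 k]
  have hsαβ : Summable fun k => α k * β k := by
    refine Summable.of_norm_bounded hr fun k => ?_
    rw [norm_mul]
    nlinarith [(hα k).trans (hsq k), (hβ k).trans (hsq k), hr0 k, hr1 k, norm_nonneg (α k),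
      norm_nonneg (β k)]
  have hdiag : ∑' m, α m * β m =
      ∑ j : Fin N, ∑' k : ℤ, α (k * N + j) * β (k * N + j) := by
    have hs := (Int.divModEquiv N).symm.summable_iff.2 hsαβ
    rw [← (Int.divModEquiv N).symm.tsum_eq]
    simp only [Function.comp_def] at hs
    simp only [hs.tsum_prod, tsum_fintype]
    rw [Summable.tsum_finsetSum]
    · simp [Int.divModEquiv]
    · intro j _
      exact hsαβ.comp_injective (hinj j)
  rw [hdiag, ← Finset.sum_sub_distrib]
  refine (norm_sum_le _ _).trans ?_
  have : ∀ j ∈ (Finset.univ : Finset (Fin N)),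
      ‖(∑' k : ℤ, α (k * N + j)) * (∑' k : ℤ, β (k * N + j)) -
        ∑' k : ℤ, α (k * N + j) * β (k * N + j)‖ ≤ δ * (∑' k, r k) ^ 2 := fun j _ => by
    have hrj : Summable fun k : ℤ => r (k * N + j) := hr.comp_injective (hinj j)
    refine (norm_tsum_mul_tsum_sub_le hrj (fun _ => hr0 _) (fun _ => hr1 _) (fun _ => hα _)
      (fun _ => hβ _) hδ0 fun k l hkl => hδ _ _ ?_).trans ?_
    -- Distinct members of one residue class differ by a nonzero multiple of `N`.
    · have h1 : k * (N : ℤ) + (j : ℤ) - (l * N + (j : ℤ)) = (k - l) * N := by ring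
      rw [h1, abs_mul, abs_of_pos hN]
      exact le_mul_of_one_le_left hN.le (Int.one_le_abs (sub_ne_zero.2 hkl))
    · have : ∑' k : ℤ, r (k * N + j) ≤ ∑' k, r k :=
        tsum_comp_le_tsum_of_inj hr hr0 (hinj j)
      have h0 : 0 ≤ ∑' k : ℤ, r (k * N + j) := tsum_nonneg fun _ => hr0 _
      gcongr
  refine (Finset.sum_le_sum this).trans (le_of_eq ?_)
  simp

/-! ### Theta functions with characteristics -/

/-- The terms of the theta functions `∑ exp (-π h² m² / 2 + π h m z)`. -/
noncomputable def thetaTerm (h : ℝ) (m : ℤ) (z : ℂ) : ℂ :=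
  Complex.exp (-(Real.pi * h ^ 2 * m ^ 2 / 2) + Real.pi * h * m * z)

/-- Expanding the square in `m = k N + j` writes the sum as `thetaTerm h j z` times `jacobiTheta₂`
at `τ = i h² N² / 2` and an argument `Z z` affine in `z`. Convergence and differentiation follow
from those of `jacobiTheta₂`. -/
theorem hasSum_thetaTerm_residue {h : ℝ} (hh : 0 < h) (N : ℕ) [NeZero N] (j : ℤ) :
    ∃ G G' : ℂ → ℂ, ∀ z, HasDerivAt G (G' z) z ∧
      HasSum (fun k : ℤ => thetaTerm h (k * N + j) z) (G z) ∧
      HasSum (fun k : ℤ => Real.pi * h * ((k * N + j : ℤ) : ℂ) * thetaTerm h (k * N + j) z)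
        (G' z) := by
  have hN : (0 : ℝ) < N := by exact_mod_cast Nat.pos_of_ne_zero (NeZero.ne N)
  set τ : ℂ := ((h ^ 2 * N ^ 2 / 2 : ℝ) : ℂ) * Complex.I with hτ
  have hτ0 : 0 < τ.im := by
    rw [hτ, Complex.im_ofReal_mul, Complex.I_im, mul_one]
    positivity
  let Z : ℂ → ℂ := fun z => -(Complex.I / 2) * (h * N * z - h ^ 2 * j * N)
  have hZ : ∀ z, HasDerivAt Z (-(Complex.I / 2) * (h * N)) z := fun z => by
    have := (((hasDerivAt_id z).const_mul ((h : ℂ) * N)).sub_const (h ^ 2 * j * N : ℂ)).const_mul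
      (-(Complex.I / 2))
    rw [mul_one] at this
    exact this
  have hE : ∀ z, HasDerivAt (thetaTerm h j) (Real.pi * h * j * thetaTerm h j z) z := fun z => by
    have := (((hasDerivAt_id z).const_mul ((Real.pi : ℂ) * h * j)).const_add
      (-(Real.pi * h ^ 2 * j ^ 2 / 2) : ℂ)).cexp
    rw [mul_comm]
    rw [mul_one] at this
    exact this
  have hterm : ∀ (k : ℤ) z, thetaTerm h j z * jacobiTheta₂_term k (Z z) τ =
      thetaTerm h (k * N + j) z := fun k z => by
    unfold thetaTerm jacobiTheta₂_term
    rw [← Complex.exp_add]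
    congr 1
    simp only [Z, hτ]
    push_cast
    linear_combination (-(Real.pi : ℂ) * k * (h * N * z - h ^ 2 * j * N) +
      Real.pi * k ^ 2 * h ^ 2 * N ^ 2 / 2) * Complex.I_sq
  refine ⟨fun z => thetaTerm h j z * jacobiTheta₂ (Z z) τ, fun z =>
    Real.pi * h * j * thetaTerm h j z * jacobiTheta₂ (Z z) τ +
      thetaTerm h j z * (jacobiTheta₂' (Z z) τ * (-(Complex.I / 2) * (h * N))), fun z => ⟨?_, ?_, ?_⟩⟩
  · exact (hE z).fun_mul (HasDerivAt.comp z (hasDerivAt_jacobiTheta₂_fst (Z z) hτ0) (hZ z))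
  · simpa only [hterm] using (hasSum_jacobiTheta₂_term (Z z) hτ0).mul_left (thetaTerm h j z)
  · have h1 := (hasSum_jacobiTheta₂_term (Z z) hτ0).mul_left (Real.pi * h * j * thetaTerm h j z)
    have h2 := ((hasSum_jacobiTheta₂'_term (Z z) hτ0).mul_right
      (-(Complex.I / 2) * (h * N))).mul_left (thetaTerm h j z)
    refine (h1.add h2).congr_fun fun k => ?_
    rw [← hterm, jacobiTheta₂'_term]
    push_cast
    linear_combination (Real.pi * h * k * N * thetaTerm h j z * jacobiTheta₂_term k (Z z) τ) *
      Complex.I_sq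

/-- The moments `(h m - x)ˢ exp (-π x² / 2) exp (-π h² m² / 2 + π h m z)`, where `x = Re z`. -/
noncomputable def thetaMoment (h : ℝ) (z : ℂ) (s : ℕ) (m : ℤ) : ℂ :=
  ((h * m - z.re) ^ s : ℝ) * (Complex.exp (-(Real.pi * z.re ^ 2 / 2)) * thetaTerm h m z)

/-- Completing the square: the factor `exp (-π x² / 2)` turns the modulus into a Gaussian in `h m -
x`. -/
theorem norm_thetaMoment (h : ℝ) (z : ℂ) (s : ℕ) (m : ℤ) :
    ‖thetaMoment h z s m‖ =
      |h * m - z.re| ^ s * Real.exp (-(Real.pi / 2) * (h * m - z.re) ^ 2) := by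
  unfold thetaMoment thetaTerm
  rw [← Complex.exp_add, norm_mul, Complex.norm_real, Real.norm_eq_abs, abs_pow, Complex.norm_exp]
  congr 2
  have : (-(Real.pi * (z.re : ℂ) ^ 2 / 2) + (-(Real.pi * (h : ℂ) ^ 2 * (m : ℂ) ^ 2 / 2) +
      Real.pi * h * m * z)) = ((-(Real.pi * z.re ^ 2 / 2) + -(Real.pi * h ^ 2 * m ^ 2 / 2) : ℝ) : ℂ)
      + ((Real.pi * h * m : ℝ) : ℂ) * z := by
    push_cast
    ring
  rw [this, Complex.add_re, Complex.re_ofReal_mul, Complex.ofReal_re]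
  ring

/-- The phases, which carry the dependence on `Im z`, cancel. -/
theorem thetaMoment_mul_conj (h : ℝ) (z : ℂ) (s t : ℕ) (m : ℤ) :
    thetaMoment h z s m * (starRingEnd ℂ) (thetaMoment h z t m) =
      (((h * m - z.re) ^ (s + t) * Real.exp (-Real.pi * (h * m - z.re) ^ 2) : ℝ) : ℂ) := by
  have h0 : ∀ s, thetaMoment h z s m = ((h * m - z.re) ^ s : ℝ) * thetaMoment h z 0 m := fun s => by
    simp [thetaMoment]
  have h1 : thetaMoment h z 0 m * (starRingEnd ℂ) (thetaMoment h z 0 m) =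
      ((Real.exp (-Real.pi * (h * m - z.re) ^ 2) : ℝ) : ℂ) := by
    rw [Complex.mul_conj', norm_thetaMoment, ← Complex.ofReal_pow, pow_zero, one_mul,
      ← Real.exp_nat_mul]
    congr 2
    push_cast
    ring
  rw [h0 s, h0 t, map_mul, Complex.conj_ofReal, Complex.ofReal_mul, ← h1, pow_add,
    Complex.ofReal_mul]
  ring

/-- Half of the Gaussian exponent absorbs the factor `|u| ^ s`; the rest is written as a square to
fit `norm_sum_residue_sub_le`. -/
theorem norm_thetaMoment_le (h : ℝ) (z : ℂ) {s : ℕ} (hs : s ≤ 1) (m : ℤ) :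
    ‖thetaMoment h z s m‖ ≤ Real.exp (-(Real.pi / 8) * (h * m - z.re) ^ 2) ^ 2 := by
  rw [norm_thetaMoment]
  set u := h * m - z.re
  have h1 : |u| ^ s ≤ Real.exp (Real.pi / 4 * u ^ 2) := by
    have h2 := Real.add_one_le_exp (Real.pi / 4 * u ^ 2)
    have h3 := Real.pi_gt_three
    have h4 := sq_abs u
    interval_cases s
    · simp only [pow_zero]
      nlinarith [sq_nonneg u]
    · rw [pow_one]
      nlinarith [sq_nonneg (|u| - 1), sq_nonneg u]
  calc |u| ^ s * Real.exp (-(Real.pi / 2) * u ^ 2)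
      ≤ Real.exp (Real.pi / 4 * u ^ 2) * Real.exp (-(Real.pi / 2) * u ^ 2) := by gcongr
    _ = Real.exp (-(Real.pi / 8) * u ^ 2) ^ 2 := by
      rw [← Real.exp_add, ← Real.exp_nat_mul]
      congr 1
      push_cast
      ring

/-- Two points at distance at least `h N` cannot both be near `x`. The crude bound `exp (-y) ≤ 1 /
y` suffices: its decay `N⁻²` beats the `N` residue classes. -/
theorem exp_mul_exp_le_of_far {h : ℝ} (hh : 0 < h) {N : ℕ} [NeZero N] (x : ℝ) {k l : ℤ}
    (hkl : (N : ℤ) ≤ |k - l|) :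
    Real.exp (-(Real.pi / 8) * (h * k - x) ^ 2) * Real.exp (-(Real.pi / 8) * (h * l - x) ^ 2) ≤
      16 / (Real.pi * h ^ 2 * N ^ 2) := by
  have hN : (0 : ℝ) < N := by exact_mod_cast Nat.pos_of_ne_zero (NeZero.ne N)
  have h1 : (N : ℝ) ^ 2 ≤ ((k : ℝ) - l) ^ 2 := by
    rw [← sq_abs ((k : ℝ) - l)]
    have : (N : ℝ) ≤ |(k : ℝ) - l| := by exact_mod_cast hkl
    gcongr
  set y := Real.pi * h ^ 2 * N ^ 2 / 16
  have hy : 0 < y := by positivity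
  have h2 : y ≤ Real.pi / 8 * ((h * k - x) ^ 2 + (h * l - x) ^ 2) := by
    have h3 : h ^ 2 * (N : ℝ) ^ 2 ≤ h ^ 2 * ((k : ℝ) - l) ^ 2 := by gcongr
    have h4 : h ^ 2 * ((k : ℝ) - l) ^ 2 ≤ 2 * ((h * k - x) ^ 2 + (h * l - x) ^ 2) := by
      nlinarith [sq_nonneg ((h * k - x) + (h * l - x))]
    have := mul_le_mul_of_nonneg_left (h3.trans h4) Real.pi_pos.le
    simp only [y]
    linarith
  calc _ = Real.exp (-(Real.pi / 8 * ((h * k - x) ^ 2 + (h * l - x) ^ 2))) := by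
        rw [← Real.exp_add]
        ring_nf
    _ ≤ Real.exp (-y) := by gcongr
    _ ≤ y⁻¹ := by
        rw [Real.exp_neg]
        gcongr
        linarith [Real.add_one_le_exp y]
    _ = _ := by simp only [y, inv_div]

/-- The Hermitian products of the moments of the theta functions with characteristics approach
the Gaussian moments. -/
theorem exists_thetaMoment_close {ε : ℝ} (hε : 0 < ε) :
    ∃ h : ℝ, 0 < h ∧ ∀ᶠ N : ℕ in atTop, ∀ z : ℂ, ∀ s ≤ 1, ∀ t ≤ 1,
      ‖h * ∑ j : Fin N, (∑' k : ℤ, thetaMoment h z s (k * N + j)) *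
        (starRingEnd ℂ) (∑' k : ℤ, thetaMoment h z t (k * N + j)) -
        ((∫ x : ℝ, x ^ (s + t) * Real.exp (-Real.pi * x ^ 2) : ℝ) : ℂ)‖ < ε := by
  choose C hC0 hC using fun k : ℕ => exists_riemannSum_gaussian_bound Real.pi_pos k
  obtain ⟨B, hB0, hB⟩ := exists_riemannSum_gaussian_bound (b := Real.pi / 8) (by positivity) 0
  set D := C 0 + C 1 + C 2
  have hD : ∀ k ≤ 2, C k ≤ D := fun k hk => by
    have := hC0 0; have := hC0 1; have := hC0 2
    interval_cases k <;> simp only [D] <;> linarith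
  have hD0 : 0 ≤ D := (hC0 0).trans (hD 0 (by norm_num))
  -- `h` is fixed first, making the Riemann sum error at most `ε / 2`; `N` is taken large
  -- afterwards, depending on `h`.
  obtain ⟨h, hh, hhD⟩ : ∃ h : ℝ, 0 < h ∧ h * D < ε / 2 :=
    ⟨ε / 2 / (D + 1), by positivity, by
      rw [div_mul_eq_mul_div, div_lt_iff₀ (by positivity)]
      nlinarith⟩
  obtain ⟨S, hS0, hS⟩ : ∃ S : ℝ, 0 ≤ S ∧ ∀ x : ℝ,
      Summable (fun m : ℤ => Real.exp (-(Real.pi / 8) * (h * m - x) ^ 2)) ∧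
      ∑' m : ℤ, Real.exp (-(Real.pi / 8) * (h * m - x) ^ 2) ≤ S := by
    refine ⟨(|∫ x : ℝ, x ^ 0 * Real.exp (-(Real.pi / 8) * x ^ 2)| + h * B) / h, by positivity,
      fun x => ?_⟩
    obtain ⟨h1, h2⟩ := hB h hh x
    simp only [pow_zero, one_mul] at h1 h2 ⊢
    refine ⟨h1, ?_⟩
    rw [le_div_iff₀ hh, mul_comm]
    have h3 := (abs_le.1 h2).2
    have h4 := le_abs_self (∫ x : ℝ, Real.exp (-(Real.pi / 8) * x ^ 2))
    linarith
  refine ⟨h, hh, ?_⟩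
  have hlim : Tendsto (fun N : ℕ => (16 * S ^ 2 / (Real.pi * h)) * (1 / (N : ℝ))) atTop (𝓝 0) := by
    simpa using (tendsto_one_div_atTop_nhds_zero_nat (𝕜 := ℝ)).const_mul
      (16 * S ^ 2 / (Real.pi * h))
  filter_upwards [hlim.eventually_lt_const (half_pos hε), eventually_ge_atTop 1] with N hN1 hN2
  intro z s hs t ht
  have : NeZero N := ⟨by omega⟩
  have hN0 : (0 : ℝ) < N := by exact_mod_cast hN2
  obtain ⟨hr, hrS⟩ := hS z.re
  set r : ℤ → ℝ := fun m => Real.exp (-(Real.pi / 8) * (h * m - z.re) ^ 2)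
  have hr0 : ∀ k, 0 ≤ r k := fun k => (Real.exp_pos _).le
  have hr1 : ∀ k, r k ≤ 1 := fun k => Real.exp_le_one_iff.2 (by
    have : 0 ≤ (h * k - z.re) ^ 2 := sq_nonneg _
    have := mul_nonneg (Real.pi_pos.le) this
    linarith)
  have hcross := norm_sum_residue_sub_le (α := thetaMoment h z s)
    (β := fun m => (starRingEnd ℂ) (thetaMoment h z t m)) N hr hr0 hr1
    (norm_thetaMoment_le h z hs) (fun k => by
      rw [RCLike.norm_conj]
      exact norm_thetaMoment_le h z ht k) (by positivity)
    (fun k l hkl => exp_mul_exp_le_of_far hh z.re hkl)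
  simp only [thetaMoment_mul_conj, ← Complex.ofReal_tsum, ← Complex.conj_tsum] at hcross
  have hdiag := (hC (s + t) h hh z.re).2
  set P := ∑ j : Fin N, (∑' k : ℤ, thetaMoment h z s (k * N + j)) *
      (starRingEnd ℂ) (∑' k : ℤ, thetaMoment h z t (k * N + j))
  set Q := ∑' m : ℤ, (h * m - z.re) ^ (s + t) * Real.exp (-Real.pi * (h * m - z.re) ^ 2)
  set M := ∫ x : ℝ, x ^ (s + t) * Real.exp (-Real.pi * x ^ 2)
  -- Cross terms `P - Q`, then the Riemann sum error.
  have h1 : (h : ℂ) * P - M = h * (P - Q) + ((h * Q - M : ℝ) : ℂ) := by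
    push_cast
    ring
  rw [h1]
  refine (norm_add_le _ _).trans_lt ?_
  rw [norm_mul, Complex.norm_real, Complex.norm_real, Real.norm_of_nonneg hh.le]
  have h2 : h * C (s + t) ≤ h * D := by
    gcongr
    exact hD _ (by omega)
  have h3 : h * ‖P - Q‖ ≤ (16 * S ^ 2 / (Real.pi * h)) * (1 / (N : ℝ)) := by
    have h4 : (∑' k, r k) ^ 2 ≤ S ^ 2 := by
      have : 0 ≤ ∑' k, r k := tsum_nonneg hr0
      gcongr
    calc h * ‖P - Q‖ ≤ h * (N * (16 / (Real.pi * h ^ 2 * N ^ 2) * S ^ 2)) := by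
          gcongr
          refine hcross.trans ?_
          gcongr
      _ = _ := by
          field_simp
  linarith

namespace CP

/-! ### Almost constant energy and the limit of the capacities -/

/-- `homogNormSq` is a function of three Hermitian products, invariant under scaling them all by `h`
and continuous at the limiting values. Thus `δ` does not depend on the index type, that is, on the
dimension. -/
theorem exists_homogNormSq_close {η : ℝ} (hη : 0 < η) :
    ∃ δ : ℝ, 0 < δ ∧ ∀ (ι : Type) [Fintype ι] (p q : ι → ℂ) (h : ℝ), 0 < h →
      ‖h * ∑ j, p j * (starRingEnd ℂ) (p j) - 1‖ < δ →
      ‖h * ∑ j, q j * (starRingEnd ℂ) (p j)‖ < δ →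
      ‖h * ∑ j, q j * (starRingEnd ℂ) (q j) - ((1 / (2 * Real.pi) : ℝ) : ℂ)‖ < δ →
      p ≠ 0 ∧ |homogNormSq p q - 1 / (2 * Real.pi)| < η := by
  let g : ℝ × ℝ × ℝ → ℝ := fun a => (a.1 * a.2.1 - a.2.2 ^ 2) / a.1 ^ 2
  have hg : ContinuousAt g (1, 1 / (2 * Real.pi), 0) := by
    refine ContinuousAt.div (by fun_prop) (by fun_prop) (by norm_num)
  obtain ⟨δ, hδ, hgδ⟩ := Metric.continuousAt_iff.1 hg η hη
  -- The bound 1 excludes `p = 0`, for which the first error would equal 1.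
  refine ⟨min δ 1, by positivity, fun ι _ p q h hh h1 h2 h3 => ?_⟩
  have hsq : ∀ p : ι → ℂ, ∑ j, p j * (starRingEnd ℂ) (p j) = ((∑ j, ‖p j‖ ^ 2 : ℝ) : ℂ) :=
    fun p => by
      push_cast
      exact Finset.sum_congr rfl fun j _ => Complex.mul_conj' _
  rw [hsq, ← Complex.ofReal_mul, ← Complex.ofReal_one, ← Complex.ofReal_sub, Complex.norm_real,
    Real.norm_eq_abs] at h1
  rw [hsq, ← Complex.ofReal_mul, ← Complex.ofReal_sub, Complex.norm_real, Real.norm_eq_abs] at h3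
  rw [norm_mul, Complex.norm_real, Real.norm_of_nonneg hh.le] at h2
  set A := ∑ j, ‖p j‖ ^ 2 with hA
  set B := ∑ j, ‖q j‖ ^ 2 with hB
  set C := ‖∑ j, q j * (starRingEnd ℂ) (p j)‖ with hC
  have hC0 : 0 ≤ C := norm_nonneg _
  constructor
  · rintro rfl
    have : A = 0 := by simp [hA]
    rw [this] at h1
    have := h1.trans_le (min_le_right _ _)
    norm_num at this
  · have h4 : homogNormSq p q = g (h * A, h * B, h * C) := by
      simp only [homogNormSq, g, ← hA, ← hB, ← hC]
      rw [← mul_div_mul_left (A * B - C ^ 2) (A ^ 2) (pow_ne_zero 2 hh.ne')]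
      ring
    have h5 : g (1, 1 / (2 * Real.pi), 0) = 1 / (2 * Real.pi) := by simp [g]
    rw [h4, ← h5, ← Real.dist_eq]
    refine hgδ ?_
    rw [Prod.dist_eq, Prod.dist_eq, Real.dist_eq, Real.dist_eq, Real.dist_eq]
    refine max_lt (h1.trans_le (min_le_left _ _)) (max_lt (h3.trans_le (min_le_left _ _)) ?_)
    rw [sub_zero, abs_of_nonneg (by positivity)]
    exact h2.trans_le (min_le_left _ _)

theorem eventually_le_capacity {η : ℝ} (hη : 0 < η) :
    ∀ᶠ n : ℕ in atTop, ENNReal.ofReal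
      ((Real.pi ^ 2 * (1 / (2 * Real.pi) - η)) / (Real.pi ^ 2 * (1 / (2 * Real.pi) + η))) ≤
        capacity n := by
  obtain ⟨δ, hδ, hclose⟩ := exists_homogNormSq_close hη
  obtain ⟨h, hh, hev⟩ := exists_thetaMoment_close hδ
  filter_upwards [(tendsto_add_atTop_nat 1).eventually hev] with n hn
  choose G G' hG using fun j : ℤ => hasSum_thetaTerm_residue hh (n + 1) j
  let F : ℂ → Fin (n + 1) → ℂ := fun z j => G j z
  let F' : ℂ → Fin (n + 1) → ℂ := fun z j => G' j z
  let p : ℂ → ℕ → Fin (n + 1) → ℂ := fun z s j =>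
    ∑' k : ℤ, thetaMoment h z s (k * (n + 1 : ℕ) + (j : ℕ))
  let e : ℂ → ℂ := fun z => Complex.exp (-(Real.pi * z.re ^ 2 / 2))
  have he : ∀ z, e z ≠ 0 := fun z => Complex.exp_ne_zero _
  have hp0 : ∀ z, p z 0 = fun j => e z * F z j := fun z => by
    funext j
    refine (((hG j z).2.1.mul_left (e z)).congr_fun fun k => ?_).tsum_eq
    simp [thetaMoment, e]
  -- Termwise, `π (h m - x) = π h m - π x`: up to the factor `e z`, the first moment is `F'`
  -- corrected by a multiple of `F`, which `homogNormSq` does not see.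
  have hp1 : ∀ z, (fun j => (Real.pi : ℂ) * p z 1 j) =
      fun j => e z * F' z j + -(Real.pi * z.re * e z) * F z j := fun z => by
    funext j
    simp only [p]
    rw [← tsum_mul_left]
    refine ((((hG j z).2.2.mul_left (e z)).add
      ((hG j z).2.1.mul_left (-(Real.pi * z.re * e z)))).congr_fun fun k => ?_).tsum_eq
    simp only [thetaMoment, e]
    push_cast
    ring
  have hQ : ∀ z, homogNormSq (F z) (F' z) = Real.pi ^ 2 * homogNormSq (p z 0) (p z 1) := fun z => by
    have := homogNormSq_smul_right (p z 0) (p z 1) (Real.pi : ℂ)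
    rw [hp1, hp0, homogNormSq_smul_add _ _ (he z), Complex.norm_real, Real.norm_eq_abs,
      sq_abs] at this
    rw [this, hp0]
  have hc : ∀ z, p z 0 ≠ 0 ∧ |homogNormSq (p z 0) (p z 1) - 1 / (2 * Real.pi)| < η := fun z => by
    refine hclose _ (p z 0) (p z 1) h hh ?_ ?_ ?_
    · have := hn z 0 (by norm_num) 0 (by norm_num)
      rw [integral_pow_mul_gaussian_zero, Complex.ofReal_one] at this
      exact this
    · have := hn z 1 (by norm_num) 0 (by norm_num)
      rw [integral_pow_mul_gaussian_succ 0, Nat.cast_zero, zero_div, zero_mul, Complex.ofReal_zero,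
        sub_zero] at this
      exact this
    · have := hn z 1 (by norm_num) 1 (by norm_num)
      rw [integral_pow_mul_gaussian_succ 1, Nat.sub_self, integral_pow_mul_gaussian_zero,
        Nat.cast_one, mul_one] at this
      exact this
  -- A zero of `F` would be a zero of `p z 0`, so there are no base points.
  refine le_capacity (F := F) (F' := F') (fun z hz => (hc z).1 ?_)
    (fun z => hasDerivAt_pi.2 fun j => (hG j z).1) (by positivity) (fun z => ?_) (fun z => ?_)
  · rw [hp0, hz]
    funext j
    simp
  · rw [hQ]
    gcongr
    linarith [(abs_lt.1 (hc z).2).1]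
  · rw [hQ]
    gcongr
    linarith [(abs_lt.1 (hc z).2).2]

theorem tendsto_capacity : Tendsto (fun n : ℕ => capacity n) atTop (𝓝 1) := by
  refine tendsto_order.2 ⟨fun a ha => ?_, fun a ha =>
    Eventually.of_forall fun n => (capacity_le_one n).trans_lt ha⟩
  have hlim : Tendsto (fun η : ℝ => ENNReal.ofReal ((Real.pi ^ 2 * (1 / (2 * Real.pi) - η)) /
      (Real.pi ^ 2 * (1 / (2 * Real.pi) + η)))) (𝓝[>] 0) (𝓝 1) := by
    have h0 : ContinuousAt (fun η : ℝ => (Real.pi ^ 2 * (1 / (2 * Real.pi) - η)) /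
        (Real.pi ^ 2 * (1 / (2 * Real.pi) + η))) 0 :=
      ContinuousAt.div (by fun_prop) (by fun_prop) (by positivity)
    have h1 : ((Real.pi ^ 2 * (1 / (2 * Real.pi) - 0)) /
        (Real.pi ^ 2 * (1 / (2 * Real.pi) + 0)) : ℝ) = 1 := by
      rw [sub_zero, add_zero]
      exact div_self (by positivity)
    have h2 := h0.tendsto
    rw [h1] at h2
    rw [← ENNReal.ofReal_one]
    exact ENNReal.tendsto_ofReal (h2.mono_left nhdsWithin_le_nhds)
  obtain ⟨η, hη, hη0⟩ := ((hlim.eventually_const_lt ha).and self_mem_nhdsWithin).exists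
  exact (eventually_le_capacity hη0).mono fun n hn => hη.trans_le hn

end CP

theorem mainTheorem2 :
    (∀ n : ℕ, 1 ≤ n → CP.capacity n ≤ CP.capacity (n + 1)) ∧
      Tendsto (fun n : ℕ => CP.capacity n) atTop (𝓝 1) :=
  ⟨fun n _ => CP.capacity_le_capacity_succ n, CP.tendsto_capacity⟩
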